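/- Let $N\ge 1$ and let $\mathcal H_1,\dots,\mathcal H_N$ be complex Hilbert spaces. A state $\rho$ on the Hilbert space tensor product $\mathcal H_1\otimes\cdots\otimes\mathcal H_N$ is a positive trace class operator of trace $1$. Let $S_1,\dots,S_N\ge 1$ be integers and $\Lambda_1,\dots,\Lambda_N$ arbitrary finite sets. Suppose that party $n$ can perform $S_n$ measurements, given by POV measures $\mathrm M_n^{(1)},\dots,\mathrm M_n^{(S_n)}$ on $\mathcal H_n$ with outcomes in $\Lambda_n$; the joint measurement $s=(s_1,\dots,s_N)$ yields the outcomes $\lambda=(\lambda_1,\dots,\lambda_N)$ with probability $$P_s(\lambda)=\operatorname{tr}\big[\rho\,\{\mathrm M_1^{(s_1)}(\lambda_1)\otimes\cdots\otimes \mathrm M_N^{(s_N)}(\lambda_N)\}\big].$$ For a family $\psi=\{\psi_s\}$ of real functions on $\Lambda_1\times\cdots\times\Lambda_N$, indexed by all $s$ with $1\le s_n\le S_n$, let $\mathcal B^{\sup}_\psi$ and $\mathcal B^{\inf}_\psi$ be the supremum and the infimum of $\sum_s\psi_s(\lambda_1^{(s_1)},\dots,\lambda_N^{(s_N)})$ over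 all choices of outcomes $\lambda_n^{(s_n)}\in\Lambda_n$ (for all $n$ and all $s_n$), and put $\mathcal B_\psi=\max\{|\mathcal B^{\sup}_\psi|,|\mathcal B^{\inf}_\psi|\}$. The maximal Bell violation by $\rho$ is $$\Upsilon^{(\rho,\Lambda)}_{S_1\times\cdots\times S_N}=\sup\ \frac{1}{\mathcal B_\psi}\Big|\sum_s\sum_{\lambda}\psi_s(\lambda)\,P_s(\lambda)\Big|,$$ where the supremum is over all POV measures $\mathrm M_n^{(s_n)}$ as above and all families $\psi$; the quotients lie in $[0,\infty]$, with $x/0=\infty$ for $x>0$ and $0/0=0$. Then, for every state $\rho$: 1. If $d_n=\dim\mathcal H_n<\infty$ for all $n$, then $$\Upsilon^{(\rho,\Lambda)}_{S_1\times\cdots\times S_N}\le 1+2^{N-1}\left[\min\left\{\frac{S_1\cdots S_N}{\max_n S_n},\frac{d_1\cdots d_N}{\max_n d_n}\right\}-1\right].$$ 2. If $d_n=\dim\mathcal H_n<\infty$ for all $n$ and $S_1=\dots=S_N=S$, then $$\Upsilon^{(\rho,\Lambda)}_{S\times\cdots\times S}\le \min\left\{(2S-1)^{N-1},\ 1+2^{N-1}\left(\frac{d_1\cdots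 d_N}{\max_n d_n}-1\right)\right\}\le 1+2^{N-1}\left[\min\left\{S^{N-1},\frac{d_1\cdots d_N}{\max_n d_n}\right\}-1\right].$$ 3. If $S_1=\dots=S_N=S$ and the spaces $\mathcal H_n$ are of arbitrary, possibly infinite, dimension, then $$\Upsilon^{(\rho,\Lambda)}_{S\times\cdots\times S}\le (2S-1)^{N-1}.$$ -/

import Mathlib

open scoped TensorProduct ComplexConjugate ENNReal

noncomputable section

namespace BellViolation

universe u v

/-! ### The Hilbert space tensor product of finitely many Hilbert spaces -/

section Tensor

open scoped ComplexOrder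

variable {N : ℕ} (H : Fin N → Type u) [∀ n, NormedAddCommGroup (H n)]
  [∀ n, InnerProductSpace ℂ (H n)]

/-- The algebraic tensor product `H 0 ⊗ ⋯ ⊗ H (N - 1)`. It is a copy of Mathlib's `⨂[ℂ] n, H n`,
which already carries the projective seminorm and not the Hilbert norm. -/
def AlgTensor : Type u := ⨂[ℂ] n, H n

instance : AddCommGroup (AlgTensor H) := inferInstanceAs (AddCommGroup (⨂[ℂ] n, H n))

instance : Module ℂ (AlgTensor H) := inferInstanceAs (Module ℂ (⨂[ℂ] n, H n))

variable {H}

/-- The linear functional `y₀ ⊗ y₁ ⊗ ⋯ ↦ ∏ n, ⟪x n, y n⟫`. -/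
def innerLeft (x : ∀ n, H n) : (⨂[ℂ] n, H n) →ₗ[ℂ] ℂ :=
  PiTensorProduct.lift
    ((MultilinearMap.mkPiAlgebra ℂ (Fin N) ℂ).compLinearMap
      fun n => (innerSL ℂ (x n) : H n →L[ℂ] ℂ).toLinearMap)

theorem innerLeft_tprod (x y : ∀ n, H n) :
    innerLeft x (PiTensorProduct.tprod ℂ y) = ∏ n, inner ℂ (x n) (y n) := by
  simp [innerLeft]

/-- The conjugate linear functional `x₀ ⊗ x₁ ⊗ ⋯ ↦ ∏ n, ⟪x n, y n⟫`. -/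
def innerRight (y : ∀ n, H n) : (⨂[ℂ] n, H n) →ₗ⋆[ℂ] ℂ where
  toFun t := conj (innerLeft y t)
  map_add' s t := by simp
  map_smul' c t := by simp

theorem innerRight_tprod (x y : ∀ n, H n) :
    innerRight y (PiTensorProduct.tprod ℂ x) = ∏ n, inner ℂ (x n) (y n) := by
  simp [innerRight, innerLeft_tprod]

theorem innerRight_ext {f g : (⨂[ℂ] n, H n) →ₗ⋆[ℂ] ℂ}
    (h : ∀ x : ∀ n, H n, f (PiTensorProduct.tprod ℂ x) = g (PiTensorProduct.tprod ℂ x)) :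
    f = g := by
  ext t
  induction t using PiTensorProduct.induction_on with
  | smul_tprod r x => simp [h]
  | add s t hs ht => simp [hs, ht]

theorem prod_inner_update (x y : ∀ n, H n) (i : Fin N) (c : H i) :
    (∏ n, inner ℂ (x n) (Function.update y i c n))
      = inner ℂ (x i) c * ∏ n ∈ Finset.univ.erase i, inner ℂ (x n) (y n) := by
  rw [← Finset.mul_prod_erase _ _ (Finset.mem_univ i)]
  congr 1
  · simp
  · refine Finset.prod_congr rfl fun n hn => ?_
    simp [Function.update_of_ne (Finset.ne_of_mem_erase hn)]

/-- The sesquilinear form on the algebraic tensor product determined by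
`⟪x₀ ⊗ x₁ ⊗ ⋯, y₀ ⊗ y₁ ⊗ ⋯⟫ = ∏ n, ⟪x n, y n⟫`. The second (linear) argument of the inner product
is written first here: `tensorForm t s` is `⟪s, t⟫`. -/
def tensorForm : (⨂[ℂ] n, H n) →ₗ[ℂ] (⨂[ℂ] n, H n) →ₗ⋆[ℂ] ℂ :=
  PiTensorProduct.lift
    { toFun := fun y => innerRight y
      map_update_add' := by
        intro d y i a b
        obtain rfl := Subsingleton.elim d (instDecidableEqFin N)
        refine innerRight_ext fun x => ?_
        simp only [LinearMap.add_apply, innerRight_tprod, prod_inner_update, inner_add_right,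
          add_mul]
      map_update_smul' := by
        intro d y i c a
        obtain rfl := Subsingleton.elim d (instDecidableEqFin N)
        refine innerRight_ext fun x => ?_
        simp only [LinearMap.smul_apply, innerRight_tprod, prod_inner_update, inner_smul_right,
          smul_eq_mul, mul_assoc] }

theorem tensorForm_tprod (x y : ∀ n, H n) :
    tensorForm (PiTensorProduct.tprod ℂ y) (PiTensorProduct.tprod ℂ x)
      = ∏ n, inner ℂ (x n) (y n) := by
  simp [tensorForm, innerRight_tprod]

theorem tensorForm_symm (s t : ⨂[ℂ] n, H n) : conj (tensorForm s t) = tensorForm t s := by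
  induction s using PiTensorProduct.induction_on with
  | smul_tprod r x =>
    induction t using PiTensorProduct.induction_on with
    | smul_tprod q y => simp [tensorForm_tprod, mul_left_comm]
    | add s t hs ht => simp only [map_add, hs, ht, LinearMap.add_apply]
  | add s t hs ht => simp only [map_add, hs, ht, LinearMap.add_apply]

theorem exists_sum_tprod (t : ⨂[ℂ] n, H n) : ∃ (k : ℕ) (c : Fin k → ℂ) (v : Fin k → ∀ n, H n),
    t = ∑ i, c i • PiTensorProduct.tprod ℂ (v i) := by
  induction t using PiTensorProduct.induction_on with
  | smul_tprod r x => exact ⟨1, fun _ => r, fun _ => x, by simp⟩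
  | add s t hs ht =>
    obtain ⟨k, c, v, rfl⟩ := hs
    obtain ⟨l, d, w, rfl⟩ := ht
    exact ⟨k + l, Fin.append c d, Fin.append v w, by simp [Fin.sum_univ_add]⟩

theorem tensorForm_sum_tprod {k : ℕ} (c : Fin k → ℂ) (v : Fin k → ∀ n, H n) :
    tensorForm (∑ i, c i • PiTensorProduct.tprod ℂ (v i))
        (∑ i, c i • PiTensorProduct.tprod ℂ (v i))
      = star c ⬝ᵥ (Matrix.of fun i j => ∏ n, Matrix.gram ℂ (fun i => v i n) i j).mulVec c := by
  simp only [map_sum, map_smul, LinearMap.sum_apply, LinearMap.smul_apply, tensorForm_tprod,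
    LinearMap.map_smulₛₗ, smul_eq_mul, dotProduct, Matrix.mulVec, Matrix.of_apply,
    Matrix.gram_apply, Finset.mul_sum, Pi.star_apply]
  refine Finset.sum_congr rfl fun i _ => Finset.sum_congr rfl fun j _ => ?_
  simp only [RCLike.star_def]
  ring

/-- Entrywise products of positive semidefinite matrices are positive semidefinite, and monotone in
the positive semidefinite order. -/
theorem posSemidef_prod {k : ℕ} (P Q : Fin N → Matrix (Fin k) (Fin k) ℂ)
    (hP : ∀ n, (P n).PosSemidef) (hQ : ∀ n, (Q n - P n).PosSemidef) (s : Finset (Fin N)) :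
    (Matrix.of fun i j => ∏ n ∈ s, P n i j).PosSemidef ∧
      ((Matrix.of fun i j => ∏ n ∈ s, Q n i j)
        - Matrix.of fun i j => ∏ n ∈ s, P n i j).PosSemidef := by
  induction s using Finset.induction_on with
  | empty =>
    refine ⟨?_, ?_⟩
    · have e : (Matrix.of fun i j => ∏ n ∈ (∅ : Finset (Fin N)), P n i j)
          = Matrix.gram ℂ fun _ : Fin k => (1 : ℂ) := by
        ext i j
        simp [Matrix.gram_apply]
      rw [e]
      exact Matrix.posSemidef_gram ℂ _
    · simpa using Matrix.PosSemidef.zero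
  | insert a s ha ih =>
    obtain ⟨h1, h2⟩ := ih
    have e1 : (Matrix.of fun i j => ∏ n ∈ insert a s, P n i j)
        = (P a).hadamard (Matrix.of fun i j => ∏ n ∈ s, P n i j) := by
      ext i j
      simp [Finset.prod_insert ha]
    refine ⟨e1 ▸ (hP a).hadamard h1, ?_⟩
    have hQa : (Q a).PosSemidef := by simpa using (hQ a).add (hP a)
    have e2 : ((Matrix.of fun i j => ∏ n ∈ insert a s, Q n i j)
          - Matrix.of fun i j => ∏ n ∈ insert a s, P n i j)
        = (Q a).hadamard ((Matrix.of fun i j => ∏ n ∈ s, Q n i j)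
            - Matrix.of fun i j => ∏ n ∈ s, P n i j)
          + (Q a - P a).hadamard (Matrix.of fun i j => ∏ n ∈ s, P n i j) := by
      ext i j
      simp [Finset.prod_insert ha]
      ring
    rw [e2]
    exact (hQa.hadamard h2).add ((hQ a).hadamard h1)

theorem tensorForm_self_nonneg (t : ⨂[ℂ] n, H n) : 0 ≤ RCLike.re (tensorForm t t) := by
  obtain ⟨k, c, v, rfl⟩ := exists_sum_tprod t
  rw [tensorForm_sum_tprod]
  have h := (posSemidef_prod (fun n => Matrix.gram ℂ (fun i => v i n))
    (fun n => Matrix.gram ℂ (fun i => v i n)) (fun n => Matrix.posSemidef_gram ℂ _)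
    (fun n => by simpa using Matrix.PosSemidef.zero) Finset.univ).1
  exact (RCLike.nonneg_iff.mp (h.dotProduct_mulVec_nonneg c)).1

theorem tensorForm_map_self_le (A : ∀ n, H n →L[ℂ] H n) (t : ⨂[ℂ] n, H n) :
    RCLike.re (tensorForm (PiTensorProduct.map (fun n => (A n).toLinearMap) t)
        (PiTensorProduct.map (fun n => (A n).toLinearMap) t))
      ≤ (∏ n, ‖A n‖) ^ 2 * RCLike.re (tensorForm t t) := by
  obtain ⟨k, c, v, rfl⟩ := exists_sum_tprod t
  have h := (posSemidef_prod (fun n => Matrix.gram ℂ (A n ∘ fun i => v i n))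
    (fun n => ‖A n‖ ^ 2 • Matrix.gram ℂ (fun i => v i n)) (fun n => Matrix.posSemidef_gram ℂ _)
    (fun n => Matrix.posSemidef_opNorm_smul_gram_sub_gram _ (A n)) Finset.univ).2
  have h' := (RCLike.nonneg_iff.mp (h.dotProduct_mulVec_nonneg c)).1
  have e : (Matrix.of fun i j => ∏ n, (‖A n‖ ^ 2 • Matrix.gram ℂ (fun i => v i n)) i j)
      = (∏ n, ‖A n‖) ^ 2 • Matrix.of fun i j => ∏ n, Matrix.gram ℂ (fun i => v i n) i j := by
    ext i j
    simp [Finset.prod_mul_distrib, Finset.prod_pow]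
  have e2 : PiTensorProduct.map (fun n => (A n).toLinearMap)
        (∑ i, c i • PiTensorProduct.tprod ℂ (v i))
      = ∑ i, c i • PiTensorProduct.tprod ℂ (fun n => A n (v i n)) := by
    simp [map_sum]
  rw [e2, tensorForm_sum_tprod, tensorForm_sum_tprod]
  rw [e, Matrix.sub_mulVec, dotProduct_sub, Matrix.smul_mulVec, dotProduct_smul, map_sub,
    sub_nonneg, RCLike.smul_re] at h'
  exact h'

/-- The inner product `⟪x₀ ⊗ x₁ ⊗ ⋯, y₀ ⊗ y₁ ⊗ ⋯⟫ = ∏ n, ⟪x n, y n⟫` of the algebraic tensor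
product. -/
instance algTensorCore : PreInnerProductSpace.Core ℂ (AlgTensor H) where
  inner s t := tensorForm (H := H) t s
  conj_inner_symm s t := tensorForm_symm (H := H) s t
  re_inner_nonneg t := tensorForm_self_nonneg (H := H) t
  add_left r s t := map_add (tensorForm (H := H) t) r s
  smul_left s t c := LinearMap.map_smulₛₗ (tensorForm (H := H) t) c s

instance : SeminormedAddCommGroup (AlgTensor H) :=
  InnerProductSpace.Core.toSeminormedAddCommGroup (𝕜 := ℂ)

instance : InnerProductSpace ℂ (AlgTensor H) := .ofCore _

variable (H) in
/-- The Hilbert space tensor product: the completion of the algebraic tensor product. -/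
abbrev HilbertTensor : Type u := UniformSpace.Completion (AlgTensor H)

/-- The elementary tensor `x₀ ⊗ x₁ ⊗ ⋯`. -/
def elemTensor (x : ∀ n, H n) : HilbertTensor H :=
  UniformSpace.Completion.coe' (show AlgTensor H from PiTensorProduct.tprod ℂ x)

theorem inner_elemTensor (x y : ∀ n, H n) :
    inner ℂ (elemTensor x) (elemTensor y) = ∏ n, inner ℂ (x n) (y n) := by
  rw [elemTensor, elemTensor, UniformSpace.Completion.inner_coe]
  exact tensorForm_tprod x y

/-- The bounded operator `A₀ ⊗ A₁ ⊗ ⋯` on the algebraic tensor product. -/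
def algTensorOp (A : ∀ n, H n →L[ℂ] H n) : AlgTensor H →L[ℂ] AlgTensor H :=
  LinearMap.mkContinuous
    (show AlgTensor H →ₗ[ℂ] AlgTensor H from
      PiTensorProduct.map fun n => (A n).toLinearMap)
    (∏ n, ‖A n‖) fun t => by
      have h := tensorForm_map_self_le A t
      refine (sq_le_sq₀ (norm_nonneg _)
        (mul_nonneg (Finset.prod_nonneg fun n _ => norm_nonneg _) (norm_nonneg _))).mp ?_
      rw [mul_pow, ← inner_self_eq_norm_sq (𝕜 := ℂ), ← inner_self_eq_norm_sq (𝕜 := ℂ)]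
      exact h

/-- The tensor product `A₀ ⊗ A₁ ⊗ ⋯` of bounded operators, a bounded operator on the Hilbert space
tensor product. -/
def tensorOp (A : ∀ n, H n →L[ℂ] H n) : HilbertTensor H →L[ℂ] HilbertTensor H :=
  (algTensorOp A).completion

theorem tensorOp_elemTensor (A : ∀ n, H n →L[ℂ] H n) (x : ∀ n, H n) :
    tensorOp A (elemTensor x) = elemTensor fun n => A n (x n) := by
  rw [tensorOp, elemTensor, ContinuousLinearMap.completion_apply_coe, elemTensor]
  congr 1
  exact PiTensorProduct.map_tprod _ _

end Tensor

/-! ### States -/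

section State

variable (K : Type u) [NormedAddCommGroup K] [InnerProductSpace ℂ K] [CompleteSpace K]

/-- The index set of a fixed Hilbert basis of `K`. -/
def basisIndex : Set K := (exists_hilbertBasis ℂ K).choose

/-- A fixed Hilbert basis of `K`. -/
def hilbertBasis : HilbertBasis (basisIndex K) ℂ K :=
  (exists_hilbertBasis ℂ K).choose_spec.choose

variable {K}

/-- The trace `∑ᵢ ⟪eᵢ, T eᵢ⟫` over a Hilbert basis, which is meant for trace class `T`: there the
series converges absolutely and its value is the same for every Hilbert basis. -/
def trace (T : K →L[ℂ] K) : ℂ :=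
  ∑' i, inner ℂ (hilbertBasis K i) (T (hilbertBasis K i))

/-- `ρ` is a state (density operator): a positive trace class operator with trace `1`. A positive
operator is trace class exactly when the series of its diagonal elements converges. -/
structure IsState (ρ : K →L[ℂ] K) : Prop where
  isPositive : ρ.IsPositive
  summable : Summable fun i => inner ℂ (hilbertBasis K i) (ρ (hilbertBasis K i))
  trace_eq_one : trace ρ = 1

end State

/-! ### Quantum correlation scenarios -/

/-- A POV measure on `H` with outcomes in the finite set `Λ`. -/
structure POVM (H : Type u) [NormedAddCommGroup H] [InnerProductSpace ℂ H]
    (Λ : Type v) [Fintype Λ] where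
  effect : Λ → H →L[ℂ] H
  isPositive : ∀ l, (effect l).IsPositive
  sum_effect : ∑ l, effect l = 1

section Scenario

variable {N : ℕ} {H : Fin N → Type u} [∀ n, NormedAddCommGroup (H n)]
  [∀ n, InnerProductSpace ℂ (H n)] {Λ : Fin N → Type v} [∀ n, Fintype (Λ n)] {S : Fin N → ℕ}

/-- The joint probability `tr[ρ (M₁^(s₁)(λ₁) ⊗ ⋯ ⊗ M_N^(s_N)(λ_N))]` of the outcomes `l` under the
joint measurement `s`, where party `n` has the `S n` measurements `M n 0, M n 1, …`. -/
def jointProb (ρ : HilbertTensor H →L[ℂ] HilbertTensor H)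
    (M : ∀ n, Fin (S n) → POVM (H n) (Λ n)) (s : ∀ n, Fin (S n)) (l : ∀ n, Λ n) : ℝ :=
  (trace (ρ ∘L tensorOp fun n => (M n (s n)).effect (l n))).re

/-- The linear combination of averages `∑_s ⟨ψ_s⟩` in the quantum scenario given by `ρ`, `M`. -/
def quantumValue (ρ : HilbertTensor H →L[ℂ] HilbertTensor H)
    (M : ∀ n, Fin (S n) → POVM (H n) (Λ n)) (ψ : (∀ n, Fin (S n)) → (∀ n, Λ n) → ℝ) : ℝ :=
  ∑ s, ∑ l, ψ s l * jointProb ρ M s l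

/-- The value `∑_s ψ_s(λ₁^(s₁), …, λ_N^(s_N))` at a deterministic assignment of outcomes to all
settings of all parties. -/
def deterministicValue (ψ : (∀ n, Fin (S n)) → (∀ n, Λ n) → ℝ) (a : ∀ n, Fin (S n) → Λ n) : ℝ :=
  ∑ s, ψ s fun n => a n (s n)

/-- The LHV constant `B^sup`. -/
def lhvSup (ψ : (∀ n, Fin (S n)) → (∀ n, Λ n) → ℝ) : ℝ :=
  ⨆ a : ∀ n, Fin (S n) → Λ n, deterministicValue ψ a

/-- The LHV constant `B^inf`. -/
def lhvInf (ψ : (∀ n, Fin (S n)) → (∀ n, Λ n) → ℝ) : ℝ :=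
  ⨅ a : ∀ n, Fin (S n) → Λ n, deterministicValue ψ a

/-- The LHV constant `B = max {|B^sup|, |B^inf|}`. -/
def lhvBound (ψ : (∀ n, Fin (S n)) → (∀ n, Λ n) → ℝ) : ℝ :=
  max |lhvSup ψ| |lhvInf ψ|

variable (Λ S) in
/-- The maximal Bell violation by `ρ` for `S n` settings and outcomes in `Λ n` at site `n`: the
supremum of `|∑_s ⟨ψ_s⟩| / B` over all scenarios (choices of POV measures) and all families `ψ`.
The quotient is taken in `[0, ∞]`, where `x / 0 = ∞` for `x ≠ 0` and `0 / 0 = 0`. -/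
def maxViolation (ρ : HilbertTensor H →L[ℂ] HilbertTensor H) : ℝ≥0∞ :=
  ⨆ (M : ∀ n, Fin (S n) → POVM (H n) (Λ n)) (ψ : (∀ n, Fin (S n)) → (∀ n, Λ n) → ℝ),
    ENNReal.ofReal |quantumValue ρ M ψ| / ENNReal.ofReal (lhvBound ψ)

end Scenario

/-- The number `m₁ ⋯ m_N / max_n m_n`. -/
def prodDivMax {N : ℕ} (m : Fin N → ℕ) : ℝ :=
  ((∏ n, m n : ℕ) : ℝ) / ((Finset.univ.sup m : ℕ) : ℝ)

end BellViolation

end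

noncomputable section

namespace BellViolation

universe u v

/-! ### Local hidden variable models -/

section Local

variable {N : ℕ} {Λ : Fin N → Type v} {S : Fin N → ℕ}

/-! A state is a mixture of vector states (`IsState.exists_hasSum_inner`, with vectors `√ρ eᵢ`) and
the Bell value is linear in the state, so it suffices to bound the value at a vector `v` by `C *
lhvBound ψ * ‖v‖ ^ 2`. Each constant `C` is the total mass of a signed decomposition of the quantum
correlations into product models. A product model is a mixture of deterministic assignments, so it
costs at most its mass times `lhvBound ψ` (`abs_sum_prod_le`). In both decompositions one site `p`
is exempt, and taking `p` with the largest number of settings or the largest dimension drops the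
largest factor.

Settings: at a site other than `p`, the `T` POV measures are signed combinations of deterministic
responses with positive operators as weights. Taken with absolute values, the weights add up to `(2T
- 1) • 1` (`POVM.exists_deterministic_decomposition`). Given the responses at those sites, the
measurements at `p` give nonnegative weights whose sum does not depend on the setting. Hence `C = ∏
(2 Sₙ - 1)` over the sites other than `p`, in any dimension, and this is at most `1 + 2 ^ (N - 1) *
(∏ Sₙ - 1)`.

Dimensions: write `v = ∑ⱼ φⱼ ⊗ eⱼ` with product orthonormal vectors `eⱼ` at the `k = N - 1` sites
other than `p`. A diagonal pair is a product model of mass `‖φⱼ‖ ^ 2`. An off-diagonal pair is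
polarized at every site and costs `2 ^ k * (‖φᵢ‖ ^ 2 + ‖φⱼ‖ ^ 2) / 2` (`abs_sum_prod_inner_le`).
With `D` basis vectors the sum is `(1 + 2 ^ k * (D - 1)) * ‖v‖ ^ 2`. -/

theorem lhvBound_nonneg (ψ : (∀ n, Fin (S n)) → (∀ n, Λ n) → ℝ) : 0 ≤ lhvBound ψ :=
  (abs_nonneg _).trans (le_max_left _ _)

variable [∀ n, Fintype (Λ n)]

theorem abs_deterministicValue_le (ψ : (∀ n, Fin (S n)) → (∀ n, Λ n) → ℝ)
    (a : ∀ n, Fin (S n) → Λ n) : |deterministicValue ψ a| ≤ lhvBound ψ := by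
  have h1 : deterministicValue ψ a ≤ lhvSup ψ :=
    le_ciSup (f := fun a : ∀ n, Fin (S n) → Λ n => deterministicValue ψ a)
      (Set.finite_range _).bddAbove a
  have h2 : lhvInf ψ ≤ deterministicValue ψ a :=
    ciInf_le (f := fun a : ∀ n, Fin (S n) → Λ n => deterministicValue ψ a)
      (Set.finite_range _).bddBelow a
  exact (abs_le_max_abs_abs h2 h1).trans (by rw [max_comm]; rfl)

/-- Distributions of the same total mass `w` are the marginals of a joint distribution. -/
theorem exists_joint_weight {T : ℕ} {A : Type v} [Fintype A] [DecidableEq A]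
    (p : Fin T → A → ℝ) (w : ℝ) (hp : ∀ t a, 0 ≤ p t a) (hw : 0 ≤ w) (h : ∀ t, ∑ a, p t a = w) :
    ∃ W : (Fin T → A) → ℝ, (∀ f, 0 ≤ W f) ∧ ∑ f, W f = w ∧
      ∀ t a, p t a = ∑ f, W f * if f t = a then 1 else 0 := by
  rcases hw.eq_or_lt with rfl | hw
  · refine ⟨0, fun _ => le_rfl, by simp, fun t a => ?_⟩
    have := (Finset.sum_eq_zero_iff_of_nonneg fun a _ => hp t a).mp (h t) a (Finset.mem_univ a)
    simpa using this
  · have key (q : Fin T → A → ℝ) : ∑ f : Fin T → A, ∏ t, q t (f t) = ∏ t, ∑ a, q t a := by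
      rw [Finset.prod_univ_sum, Fintype.piFinset_univ]
    -- The settings are made independent; normalizing by `w` is why mass zero is treated separately.
    refine ⟨fun f => w * ∏ t, p t (f t) / w, fun f => ?_, ?_, fun t a => ?_⟩
    · exact mul_nonneg hw.le (Finset.prod_nonneg fun t _ => div_nonneg (hp t _) hw.le)
    · rw [← Finset.mul_sum, key fun t a => p t a / w]
      simp [← Finset.sum_div, h, hw.ne']
    · have e (f : Fin T → A) : (w * ∏ t', p t' (f t') / w) * (if f t = a then 1 else 0)
          = w * ∏ t', p t' (f t') / w * if t' = t then (if f t' = a then 1 else 0) else 1 := by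
        rw [Finset.prod_mul_distrib, Finset.prod_ite_eq' Finset.univ t]
        simp
      simp_rw [e]
      rw [← Finset.mul_sum,
        key fun t' b => p t' b / w * if t' = t then (if b = a then 1 else 0) else 1,
        Finset.prod_eq_single t]
      · simp [mul_div_cancel₀ _ hw.ne']
      · intro t' _ ht'
        simp [ht', ← Finset.sum_div, h, hw.ne']
      · simp

/-- The value of a product model is bounded by the LHV constant. -/
theorem abs_sum_prod_le (ψ : (∀ n, Fin (S n)) → (∀ n, Λ n) → ℝ)
    (p : ∀ n, Fin (S n) → Λ n → ℝ) (w : Fin N → ℝ) (hp : ∀ n s l, 0 ≤ p n s l)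
    (hw : ∀ n, 0 ≤ w n) (h : ∀ n s, ∑ l, p n s l = w n) :
    |∑ s, ∑ l, ψ s l * ∏ n, p n (s n) (l n)| ≤ (∏ n, w n) * lhvBound ψ := by
  classical
  choose W hW0 hW1 hW using fun n => exists_joint_weight (p n) (w n) (hp n) (hw n) (h n)
  -- Each site answers all its settings at once, so the model becomes a mixture of deterministic
  -- assignments `a`.
  have key (s : ∀ n, Fin (S n)) (l : ∀ n, Λ n) : ∏ n, p n (s n) (l n)
      = ∑ a : ∀ n, Fin (S n) → Λ n, (∏ n, W n (a n)) *
          if (fun n => a n (s n)) = l then 1 else 0 := by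
    simp_rw [hW]
    rw [Finset.prod_univ_sum, Fintype.piFinset_univ]
    refine Finset.sum_congr rfl fun a _ => ?_
    rw [Finset.prod_mul_distrib, Finset.prod_ite_zero]
    simp [funext_iff]
  have e : ∑ s, ∑ l, ψ s l * ∏ n, p n (s n) (l n)
      = ∑ a : ∀ n, Fin (S n) → Λ n, (∏ n, W n (a n)) * deterministicValue ψ a := by
    simp_rw [key, Finset.mul_sum, deterministicValue]
    rw [Finset.sum_congr rfl fun s _ => Finset.sum_comm, Finset.sum_comm]
    refine Finset.sum_congr rfl fun a _ => ?_
    rw [Finset.mul_sum]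
    refine Finset.sum_congr rfl fun s _ => ?_
    simp [mul_comm]
  have e' : ∏ n, w n = ∑ a : ∀ n, Fin (S n) → Λ n, ∏ n, W n (a n) := by
    simp_rw [← hW1]
    rw [Finset.prod_univ_sum, Fintype.piFinset_univ]
  rw [e, e', Finset.sum_mul]
  refine (Finset.abs_sum_le_sum_abs _ _).trans (Finset.sum_le_sum fun a _ => ?_)
  have h0 : 0 ≤ ∏ n, W n (a n) := Finset.prod_nonneg fun n _ => hW0 n _
  rw [abs_mul, abs_of_nonneg h0]
  exact mul_le_mul_of_nonneg_left (abs_deterministicValue_le ψ a) h0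

end Local

/-! ### Numerical facts -/

theorem one_le_prod_and_prod_two_mul_sub_one_le {k : ℕ} (m : Fin k → ℕ) (hm : ∀ i, 1 ≤ m i) :
    (1 : ℝ) ≤ ∏ i, (m i : ℝ) ∧
      ∏ i, (2 * (m i : ℝ) - 1) ≤ 1 + 2 ^ k * (∏ i, (m i : ℝ) - 1) := by
  induction k with
  | zero => simp
  | succ k ih =>
    obtain ⟨h1, h2⟩ := ih (fun i => m i.castSucc) fun i => hm _
    have h : (1 : ℝ) ≤ m (Fin.last k) := by exact_mod_cast hm _
    have h3 : (1 : ℝ) ≤ 2 ^ k := one_le_pow₀ (by norm_num)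
    rw [Fin.prod_univ_castSucc, Fin.prod_univ_castSucc]
    generalize ∏ i : Fin k, (m i.castSucc : ℝ) = P at *
    generalize ∏ i : Fin k, (2 * (m i.castSucc : ℝ) - 1) = Q at *
    generalize (m (Fin.last k) : ℝ) = x at *
    refine ⟨one_le_mul_of_one_le_of_one_le h1 h, ?_⟩
    -- After multiplying the induction hypothesis by `2x - 1`, the remaining slack is `2(2^k - 1)(x
    -- - 1) + 2^k(P - 1)`, which `h5` and `h6` make nonnegative.
    have h4 := mul_le_mul_of_nonneg_right h2 (by linarith : 0 ≤ 2 * x - 1)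
    have h5 := mul_nonneg (sub_nonneg.2 h3) (sub_nonneg.2 h)
    have h6 := mul_nonneg (by positivity : (0 : ℝ) ≤ 2 ^ k) (sub_nonneg.2 h1)
    rw [pow_succ]
    linarith

theorem prodDivMax_eq_prod_succAbove {k : ℕ} (m : Fin (k + 1) → ℕ) (p : Fin (k + 1))
    (hp : ∀ n, m n ≤ m p) (h0 : m p ≠ 0) :
    prodDivMax m = ∏ i, (m (p.succAbove i) : ℝ) := by
  have e : Finset.univ.sup m = m p :=
    le_antisymm (Finset.sup_le fun n _ => hp n) (Finset.le_sup (Finset.mem_univ p))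
  have h0' : (m p : ℝ) ≠ 0 := by exact_mod_cast h0
  rw [prodDivMax, e, Fin.prod_univ_succAbove _ p]
  push_cast
  field_simp

/-! ### Tensor products of operators -/

section TensorOp

variable {N : ℕ} {H : Fin N → Type u} [∀ n, NormedAddCommGroup (H n)]
  [∀ n, InnerProductSpace ℂ (H n)]

theorem tprod_mem_span (t : AlgTensor H) :
    t ∈ Submodule.span ℂ (Set.range fun x : ∀ n, H n =>
      (show AlgTensor H from PiTensorProduct.tprod ℂ x)) := by
  have h := PiTensorProduct.span_tprod_eq_top (R := ℂ) (s := H)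
  exact h.symm ▸ (Submodule.mem_top : (show (⨂[ℂ] n, H n) from t) ∈ ⊤)

/-- Bounded operators are determined by their values on elementary tensors. -/
theorem ext_elemTensor {F : Type*} [NormedAddCommGroup F] [NormedSpace ℂ F]
    {f g : HilbertTensor H →L[ℂ] F} (h : ∀ x, f (elemTensor x) = g (elemTensor x)) : f = g := by
  ext v
  induction v using UniformSpace.Completion.induction_on with
  | hp => exact isClosed_eq f.continuous g.continuous
  | ih t =>
    have ht := tprod_mem_span t
    induction ht using Submodule.span_induction with
    | mem x hx =>
      obtain ⟨x, rfl⟩ := hx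
      exact h x
    | zero => rw [UniformSpace.Completion.coe_zero, map_zero, map_zero]
    | add s t _ _ hs ht => rw [UniformSpace.Completion.coe_add, map_add, map_add, hs, ht]
    | smul c t _ ht => rw [UniformSpace.Completion.coe_smul, map_smul, map_smul, ht]

/-- The elementary tensor as a multilinear map. -/
def elemTensorMultilinear : MultilinearMap ℂ H (HilbertTensor H) :=
  (UniformSpace.Completion.toComplL (𝕜 := ℂ) (E := AlgTensor H)).toLinearMap.compMultilinearMap
    (show MultilinearMap ℂ H (AlgTensor H) from PiTensorProduct.tprod ℂ)

theorem elemTensorMultilinear_apply (x : ∀ n, H n) :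
    elemTensorMultilinear x = elemTensor x := rfl

/-- The tensor product of operators as a multilinear map. -/
def tensorOpMultilinear : MultilinearMap ℂ (fun n => H n →L[ℂ] H n)
    (HilbertTensor H →L[ℂ] HilbertTensor H) where
  toFun := tensorOp
  map_update_add' := by
    intro d A i B C
    obtain rfl := Subsingleton.elim d (instDecidableEqFin N)
    refine ext_elemTensor fun x => ?_
    have e (D : H i →L[ℂ] H i) : (fun n => Function.update A i D n (x n))
        = Function.update (fun n => A n (x n)) i (D (x i)) := by
      ext n
      rcases eq_or_ne n i with rfl | hn <;> simp [*]
    rw [add_apply]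
    simp only [tensorOp_elemTensor, e]
    exact elemTensorMultilinear.map_update_add (fun n => A n (x n)) i (B (x i)) (C (x i))
  map_update_smul' := by
    intro d A i c B
    obtain rfl := Subsingleton.elim d (instDecidableEqFin N)
    refine ext_elemTensor fun x => ?_
    have e (D : H i →L[ℂ] H i) : (fun n => Function.update A i D n (x n))
        = Function.update (fun n => A n (x n)) i (D (x i)) := by
      ext n
      rcases eq_or_ne n i with rfl | hn <;> simp [*]
    rw [smul_apply]
    simp only [tensorOp_elemTensor, e]
    exact elemTensorMultilinear.map_update_smul (fun n => A n (x n)) i c (B (x i))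

theorem tensorOp_one : tensorOp (fun n => (1 : H n →L[ℂ] H n)) = 1 :=
  ext_elemTensor fun x => by simp [tensorOp_elemTensor]

theorem tensorOp_mul (A B : ∀ n, H n →L[ℂ] H n) :
    tensorOp (fun n => A n * B n) = tensorOp A * tensorOp B :=
  ext_elemTensor fun x => by simp [tensorOp_elemTensor]

theorem inner_tensorOp_left [∀ n, CompleteSpace (H n)] (A : ∀ n, H n →L[ℂ] H n)
    (v w : HilbertTensor H) :
    inner ℂ (tensorOp (fun n => ContinuousLinearMap.adjoint (A n)) v) w
      = inner ℂ v (tensorOp A w) := by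
  rw [← ContinuousLinearMap.adjoint_inner_left]
  congr 1
  refine DFunLike.congr_fun (ext_elemTensor fun x => ?_) v
  refine ext_inner_right ℂ fun w => ?_
  rw [ContinuousLinearMap.adjoint_inner_left, tensorOp_elemTensor]
  refine DFunLike.congr_fun
    (f := innerSL ℂ (elemTensor fun n => ContinuousLinearMap.adjoint (A n) (x n)))
    (g := (innerSL ℂ (elemTensor x)).comp (tensorOp A)) (ext_elemTensor fun y => ?_) w
  simp [tensorOp_elemTensor, inner_elemTensor, ContinuousLinearMap.adjoint_inner_left]

/-- The tensor product of the `A n` is the square of the self-adjoint tensor product of their square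
roots. -/
theorem inner_tensorOp_self_nonneg [∀ n, CompleteSpace (H n)] (A : ∀ n, H n →L[ℂ] H n)
    (hA : ∀ n, (A n).IsPositive) (v : HilbertTensor H) :
    0 ≤ (inner ℂ v (tensorOp A v)).re := by
  have hA' (n) : 0 ≤ A n := (ContinuousLinearMap.nonneg_iff_isPositive _).2 (hA n)
  have e : A = fun n => CFC.sqrt (A n) * CFC.sqrt (A n) := by
    ext1 n
    exact (CFC.sqrt_mul_sqrt_self (A n) (hA' n)).symm
  have hs (n) : ContinuousLinearMap.adjoint (CFC.sqrt (A n)) = CFC.sqrt (A n) :=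
    ((ContinuousLinearMap.nonneg_iff_isPositive _).1
      (CFC.sqrt_nonneg (A n))).isSelfAdjoint.adjoint_eq
  rw [e, tensorOp_mul, mul_apply_eq_comp, ← inner_tensorOp_left]
  simp only [hs]
  exact inner_self_nonneg (𝕜 := ℂ)

variable (H) in
/-- The multilinear form `A ↦ ⟪v, (A₀ ⊗ A₁ ⊗ ⋯) v⟫`. -/
def tensorExpectation (v : HilbertTensor H) :
    MultilinearMap ℂ (fun n => H n →L[ℂ] H n) ℂ :=
  ((innerSL ℂ v).comp
    (ContinuousLinearMap.apply ℂ (HilbertTensor H) v)).toLinearMap.compMultilinearMap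
      tensorOpMultilinear

theorem tensorExpectation_apply (v : HilbertTensor H) (A : ∀ n, H n →L[ℂ] H n) :
    tensorExpectation H v A = inner ℂ v (tensorOp A v) := rfl

end TensorOp

/-! ### Traces against a state -/

section Trace

variable {K : Type u} [NormedAddCommGroup K] [InnerProductSpace ℂ K]

theorem hasSum_norm_inner_sq {ι : Type*} (b : HilbertBasis ι ℂ K) (x : K) :
    HasSum (fun i => ‖inner ℂ (b i) x‖ ^ 2) (‖x‖ ^ 2) := by
  have h := b.hasSum_inner_mul_inner x x
  have h' := Complex.hasSum_re h
  convert h' using 1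
  · ext i
    rw [← inner_conj_symm x, ← Complex.normSq_eq_conj_mul_self, Complex.ofReal_re,
      Complex.normSq_eq_norm_sq]
  · exact (inner_self_eq_norm_sq (𝕜 := ℂ) x).symm

/-- Parseval in the first index. It supplies the Hilbert–Schmidt summability behind the exchange of
sums in `trace_comp_eq_tsum_inner`. -/
theorem summable_norm_inner_sq {ι : Type*} (b : HilbertBasis ι ℂ K) (g : ι → K)
    (hg : Summable fun j => ‖g j‖ ^ 2) :
    Summable fun q : ι × ι => ‖inner ℂ (b q.1) (g q.2)‖ ^ 2 := by
  have h : Summable fun q : ι × ι => ‖inner ℂ (b q.2) (g q.1)‖ ^ 2 := by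
    refine (summable_prod_of_nonneg fun _ => sq_nonneg _).2
      ⟨fun j => (hasSum_norm_inner_sq b (g j)).summable, ?_⟩
    simpa only [(hasSum_norm_inner_sq b _).tsum_eq] using hg
  exact (Equiv.prodComm ι ι).summable_iff.1 h

variable [CompleteSpace K]

/-- Cyclicity, `tr(R²A) = tr(RAR)`, for `R` Hilbert–Schmidt: insert a resolution of the identity and
exchange the two sums. The double series converges absolutely, being a product of two
square-summable families. -/
theorem trace_comp_eq_tsum_inner (R A : K →L[ℂ] K) (hR : IsSelfAdjoint R)
    (h : Summable fun i => ‖R (hilbertBasis K i)‖ ^ 2) :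
    trace ((R * R) ∘L A)
      = ∑' i, inner ℂ (R (hilbertBasis K i)) (A (R (hilbertBasis K i))) := by
  set e := hilbertBasis K
  have hR' (x y : K) : inner ℂ (R x) y = inner ℂ x (R y) := by
    rw [← ContinuousLinearMap.adjoint_inner_left, hR.adjoint_eq]
  let f : basisIndex K → basisIndex K → ℂ := fun i j =>
    inner ℂ (R (e i)) (e j) * inner ℂ (e j) (R (A (e i)))
  have hf (i j) : f i j = inner ℂ (ContinuousLinearMap.adjoint A (R (e j))) (e i)
      * inner ℂ (e i) (R (e j)) := by
    simp only [f]
    rw [hR', ContinuousLinearMap.adjoint_inner_left, hR' (e j), mul_comm]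
  have hs1 := summable_norm_inner_sq e (fun j => R (e j)) h
  have hs2 := summable_norm_inner_sq e (fun j => ContinuousLinearMap.adjoint A (R (e j))) <| by
    refine Summable.of_nonneg_of_le (fun _ => sq_nonneg _) (fun j => ?_)
      (h.mul_left (‖ContinuousLinearMap.adjoint A‖ ^ 2))
    rw [← mul_pow]
    gcongr
    exact ContinuousLinearMap.le_opNorm _ _
  have hs : Summable (Function.uncurry f) := by
    refine Summable.of_norm_bounded (hs1.add hs2) fun q => ?_
    rw [Function.uncurry, hf, norm_mul, norm_inner_symm]
    nlinarith [sq_nonneg (‖inner ℂ (e q.1) (ContinuousLinearMap.adjoint A (R (e q.2)))‖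
      - ‖inner ℂ (e q.1) (R (e q.2))‖), sq_nonneg ‖inner ℂ (e q.1) (R (e q.2))‖,
      sq_nonneg ‖inner ℂ (e q.1) (ContinuousLinearMap.adjoint A (R (e q.2)))‖]
  calc trace ((R * R) ∘L A) = ∑' i, ∑' j, f i j := by
        refine tsum_congr fun i => ?_
        rw [e.tsum_inner_mul_inner, hR']
        rfl
    _ = ∑' j, ∑' i, f i j := hs.tsum_comm.symm
    _ = _ := by
        refine tsum_congr fun j => ?_
        simp_rw [hf]
        rw [e.tsum_inner_mul_inner, ContinuousLinearMap.adjoint_inner_left]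

/-- A state is a mixture of vector states. -/
theorem IsState.exists_hasSum_inner {ρ : K →L[ℂ] K} (hρ : IsState ρ) :
    ∃ w : basisIndex K → K, HasSum (fun i => ‖w i‖ ^ 2) 1 ∧ ∀ A : K →L[ℂ] K,
      HasSum (fun i => (inner ℂ (w i) (A (w i))).re) (trace (ρ ∘L A)).re := by
  have hρ' : 0 ≤ ρ := (ContinuousLinearMap.nonneg_iff_isPositive _).2 hρ.isPositive
  have hR : IsSelfAdjoint (CFC.sqrt ρ) :=
    ((ContinuousLinearMap.nonneg_iff_isPositive _).1 (CFC.sqrt_nonneg ρ)).isSelfAdjoint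
  have hRR := CFC.sqrt_mul_sqrt_self ρ hρ'
  set R := CFC.sqrt ρ
  have e (i) : inner ℂ (hilbertBasis K i) (ρ (hilbertBasis K i))
      = ((‖R (hilbertBasis K i)‖ ^ 2 : ℝ) : ℂ) := by
    rw [← hRR, mul_apply_eq_comp, ← ContinuousLinearMap.adjoint_inner_left,
      hR.adjoint_eq, inner_self_eq_norm_sq_to_K]
    simp
  have h : HasSum (fun i => ‖R (hilbertBasis K i)‖ ^ 2) 1 := by
    have h := hρ.summable.hasSum
    rw [← trace, hρ.trace_eq_one] at h
    simp_rw [e] at h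
    exact Complex.hasSum_ofReal.1 (by simpa using h)
  refine ⟨fun i => R (hilbertBasis K i), h, fun A => ?_⟩
  have hs : Summable fun i => inner ℂ (R (hilbertBasis K i)) (A (R (hilbertBasis K i))) := by
    refine Summable.of_norm_bounded (h.summable.mul_left ‖A‖) fun i => ?_
    refine (norm_inner_le_norm _ _).trans ?_
    have := mul_le_mul_of_nonneg_left (A.le_opNorm (R (hilbertBasis K i)))
      (norm_nonneg (R (hilbertBasis K i)))
    linarith
  have := hs.hasSum
  rw [← trace_comp_eq_tsum_inner R A hR h.summable, hRR] at this
  exact Complex.hasSum_re this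

end Trace

/-! ### Bounds for vector states -/

section Site

variable {E : Type u} [NormedAddCommGroup E] [InnerProductSpace ℂ E] {A : Type v} [Fintype A]

theorem POVM.re_inner_nonneg (M : POVM E A) (a : A) (x : E) :
    0 ≤ (inner ℂ x (M.effect a x)).re :=
  (Complex.nonneg_iff.1 ((M.isPositive a).inner_nonneg_right x)).1

theorem POVM.inner_eq_re (M : POVM E A) (a : A) (x : E) :
    inner ℂ x (M.effect a x) = ((inner ℂ x (M.effect a x)).re : ℂ) :=
  Complex.ext rfl (Complex.nonneg_iff.1 ((M.isPositive a).inner_nonneg_right x)).2.symm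

theorem POVM.sum_re_inner (M : POVM E A) (x : E) :
    ∑ a, (inner ℂ x (M.effect a x)).re = ‖x‖ ^ 2 := by
  rw [← Complex.re_sum, ← inner_sum, ← sum_apply, M.sum_effect]
  exact inner_self_eq_norm_sq (𝕜 := ℂ) x

/-- Finitely many POV measures as a signed combination of POV measures that are all given by
deterministic responses to one joint measurement. -/
theorem POVM.exists_deterministic_decomposition {T : ℕ} (hT : 1 ≤ T) (M : Fin T → POVM E A)
    [DecidableEq A] (a₀ : A) :
    ∃ (I : Type v) (_ : Fintype I) (c : I → ℝ) (r : I → Fin T → A) (K : I → E →L[ℂ] E),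
      (∀ i, (K i).IsPositive) ∧
      (∀ t a, (M t).effect a = ∑ i, ((c i * if r i t = a then 1 else 0 : ℝ) : ℂ) • K i) ∧
      ∑ i, ((|c i| : ℝ) : ℂ) • K i = ((2 * T - 1 : ℝ) : ℂ) • 1 := by
  have hT' : (1 : ℝ) ≤ T := by exact_mod_cast hT
  -- Outcome `b` of measurement `t'` answers `b` to setting `t'` and the default `a₀` to all others.
  -- Summing over all `t'` gives `(M t).effect a` plus `T - 1` spurious copies of the identity when
  -- `a = a₀`; the `Unit` term, with coefficient `-(T - 1)`, removes them. The absolute mass is `T +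
  -- (T - 1)`.
  refine ⟨Fin T × A ⊕ Unit, inferInstance, Sum.elim (fun _ => 1) fun _ => -(T - 1),
    Sum.elim (fun q t => if t = q.1 then q.2 else a₀) fun _ _ => a₀,
    Sum.elim (fun q => (M q.1).effect q.2) fun _ => 1, ?_, fun t a => ?_, ?_⟩
  · rintro (q | q)
    · exact (M q.1).isPositive q.2
    · exact ContinuousLinearMap.isPositive_one
  · rw [Fintype.sum_sum_type, Fintype.sum_prod_type]
    change _ = _ + ∑ _u : Unit, ((-((T : ℝ) - 1) * if a₀ = a then 1 else 0 : ℝ) : ℂ) •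
      (1 : E →L[ℂ] E)
    have h (t' : Fin T) : ∑ b, ((1 * if (if t = t' then b else a₀) = a then 1 else 0 : ℝ) : ℂ) •
        (M t').effect b
        = ((if a₀ = a then 1 else 0 : ℂ) • (1 : E →L[ℂ] E)) +
          if t = t' then (M t).effect a - (if a₀ = a then 1 else 0 : ℂ) • (1 : E →L[ℂ] E)
            else 0 := by
      rcases eq_or_ne t t' with rfl | ht
      · simp [ite_smul]
      · simp only [ht, if_false, ← Finset.smul_sum, (M t').sum_effect]
        simp
    simp only [Sum.elim_inl, h]
    rw [Finset.sum_add_distrib, Finset.sum_ite_eq]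
    simp only [Finset.sum_const, Finset.card_univ, Fintype.card_fin, Finset.mem_univ, if_true,
      Fintype.card_unit, one_smul]
    rw [← Nat.cast_smul_eq_nsmul ℂ T]
    by_cases ha : a₀ = a
    · simp only [if_pos ha]
      push_cast
      module
    · simp only [if_neg ha]
      push_cast
      module
  · rw [Fintype.sum_sum_type, Fintype.sum_prod_type]
    simp only [Sum.elim_inl, Sum.elim_inr, abs_one, Complex.ofReal_one, one_smul,
      POVM.sum_effect, Finset.sum_const, Finset.card_univ, Fintype.card_fin, Fintype.card_unit,
      abs_neg, abs_of_nonneg (sub_nonneg.2 hT')]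
    rw [← Nat.cast_smul_eq_nsmul ℂ T]
    push_cast
    module

/-- Polarization: off-diagonal elements of the form as a combination of diagonal ones. -/
theorem exists_polarization (x y : E) : ∃ (ω : Fin 4 → ℂ) (z : Fin 4 → E),
    (∀ m, ‖ω m‖ = 1) ∧ (∑ m, ‖z m‖ ^ 2 / 4 = ‖x‖ ^ 2 + ‖y‖ ^ 2) ∧
      ∀ B : E →L[ℂ] E, inner ℂ x (B y) = ∑ m, ω m * (inner ℂ (z m) (B (z m)) / 4) := by
  refine ⟨![1, -1, -Complex.I, Complex.I],
    ![x + y, x - y, x + Complex.I • y, x - Complex.I • y], ?_, ?_, fun B => ?_⟩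
  · simp [Fin.forall_fin_succ]
  · have h1 := parallelogram_law_with_norm ℂ x y
    have h2 := parallelogram_law_with_norm ℂ x (Complex.I • y)
    rw [norm_smul, Complex.norm_I, one_mul] at h2
    simp only [Fin.sum_univ_four, Matrix.cons_val]
    linarith
  · simp only [Fin.sum_univ_four, Matrix.cons_val, map_add, map_sub, map_smul, inner_add_left,
      inner_add_right, inner_sub_left, inner_sub_right, inner_smul_left, inner_smul_right,
      Complex.conj_I]
    linear_combination (inner ℂ x (B y) / 2 - inner ℂ y (B x) / 2) * Complex.I_sq

end Site

/-! ### The two decompositions of a vector state -/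

section Vector

variable {k : ℕ} {H : Fin (k + 1) → Type u} [∀ n, NormedAddCommGroup (H n)]
  [∀ n, InnerProductSpace ℂ (H n)] {Λ : Fin (k + 1) → Type v} [∀ n, Fintype (Λ n)]
  {S : Fin (k + 1) → ℕ}

/-- `abs_sum_prod_le` with the site `p` split off, since `p` is treated differently from the other
sites in both decompositions. -/
theorem abs_sum_mul_prod_succAbove_le (p : Fin (k + 1))
    (ψ : (∀ n, Fin (S n)) → (∀ n, Λ n) → ℝ) (g : Fin (S p) → Λ p → ℝ) (G : ℝ)
    (hg : ∀ s l, 0 ≤ g s l) (hG : 0 ≤ G) (hgG : ∀ s, ∑ l, g s l = G)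
    (q : ∀ i, Fin (S (p.succAbove i)) → Λ (p.succAbove i) → ℝ) (w : Fin k → ℝ)
    (hq : ∀ i s l, 0 ≤ q i s l) (hw : ∀ i, 0 ≤ w i) (h : ∀ i s, ∑ l, q i s l = w i) :
    |∑ s, ∑ l, ψ s l * (g (s p) (l p) * ∏ i, q i (s (p.succAbove i)) (l (p.succAbove i)))|
      ≤ G * (∏ i, w i) * lhvBound ψ := by
  have := abs_sum_prod_le ψ (p.insertNth (α := fun n => Fin (S n) → Λ n → ℝ) g q)
    (p.insertNth (α := fun _ => ℝ) G w)
    ((Fin.forall_iff_succAbove p).2 ⟨by simpa using hg, by simpa using hq⟩)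
    ((Fin.forall_iff_succAbove p).2 ⟨by simpa using hG, by simpa using hw⟩)
    ((Fin.forall_iff_succAbove p).2 ⟨by simpa using hgG, by simpa using h⟩)
  simpa only [Fin.prod_univ_succAbove _ p, Fin.insertNth_apply_same,
    Fin.insertNth_apply_succAbove] using this

/-- Vector states: the bound by the numbers of settings. -/
theorem abs_sum_tensorExpectation_le_settings [∀ n, CompleteSpace (H n)] (p : Fin (k + 1))
    (hS : ∀ n, 1 ≤ S n) (M : ∀ n, Fin (S n) → POVM (H n) (Λ n))
    (ψ : (∀ n, Fin (S n)) → (∀ n, Λ n) → ℝ) (v : HilbertTensor H) :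
    |∑ s, ∑ l, ψ s l * (tensorExpectation H v fun n => (M n (s n)).effect (l n)).re|
      ≤ (∏ i, (2 * (S (p.succAbove i) : ℝ) - 1)) * lhvBound ψ * ‖v‖ ^ 2 := by
  classical
  have hC (i) : (0 : ℝ) ≤ 2 * (S (p.succAbove i) : ℝ) - 1 := by
    have : (1 : ℝ) ≤ S (p.succAbove i) := by exact_mod_cast hS _
    linarith
  -- The decomposition needs a default outcome at each site; if some site has none, the sum over
  -- joint outcomes is empty.
  by_cases hΛ : ∃ n, IsEmpty (Λ n)
  · obtain ⟨n, hn⟩ := hΛ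
    have : IsEmpty (∀ n, Λ n) := ⟨fun l => hn.elim (l n)⟩
    simp only [Finset.univ_eq_empty, Finset.sum_empty, Finset.sum_const_zero, abs_zero]
    exact mul_nonneg (mul_nonneg (Finset.prod_nonneg fun i _ => hC i) (lhvBound_nonneg ψ))
      (sq_nonneg _)
  simp only [not_exists, not_isEmpty_iff] at hΛ
  choose I hI c r K hK0 hK1 hK2 using fun i : Fin k =>
    POVM.exists_deterministic_decomposition (hS (p.succAbove i)) (M (p.succAbove i))
      (hΛ (p.succAbove i)).some
  set Φ := (tensorExpectation H v).curryMid p with hΦ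
  let G (i : ∀ j, I j) (B : H p →L[ℂ] H p) : ℝ := (Φ B fun j => K j (i j)).re
  have hG0 (i) (B : H p →L[ℂ] H p) (hB : B.IsPositive) : 0 ≤ G i B := by
    refine inner_tensorOp_self_nonneg _ ((Fin.forall_iff_succAbove p).2 ⟨?_, fun j => ?_⟩) v
    · simpa using hB
    · simpa using hK0 j (i j)
  have hexp (s : ∀ n, Fin (S n)) (l : ∀ n, Λ n) :
      (tensorExpectation H v fun n => (M n (s n)).effect (l n)).re
        = ∑ i : ∀ j, I j, (∏ j, c j (i j)) * (G i ((M p (s p)).effect (l p)) *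
          ∏ j, if r j (i j) (s (p.succAbove j)) = l (p.succAbove j) then 1 else 0) := by
    have e : (tensorExpectation H v fun n => (M n (s n)).effect (l n))
        = Φ ((M p (s p)).effect (l p)) fun j =>
          (M (p.succAbove j) (s (p.succAbove j))).effect (l (p.succAbove j)) := by
      rw [hΦ, MultilinearMap.curryMid_apply_apply]
      exact congrArg _ (Fin.insertNth_self_removeNth p _).symm
    rw [e]
    simp only [hK1]
    rw [MultilinearMap.map_sum, Complex.re_sum]
    refine Finset.sum_congr rfl fun i _ => ?_
    rw [MultilinearMap.map_smul_univ, ← Complex.ofReal_prod, smul_eq_mul, Complex.re_ofReal_mul,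
      Finset.prod_mul_distrib]
    ring
  -- Expanding the tensor product of the operators `∑ |c| • K = (2S - 1) • 1` computes the total
  -- absolute mass.
  have hone : ∑ i : ∀ j, I j, (∏ j, |c j (i j)|) * G i 1
      = (∏ i, (2 * (S (p.succAbove i) : ℝ) - 1)) * ‖v‖ ^ 2 := by
    have e : (Φ 1 fun j => ∑ i, ((|c j i| : ℝ) : ℂ) • K j i).re
        = ∑ i : ∀ j, I j, (∏ j, |c j (i j)|) * G i 1 := by
      rw [MultilinearMap.map_sum, Complex.re_sum]
      refine Finset.sum_congr rfl fun i _ => ?_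
      rw [MultilinearMap.map_smul_univ, ← Complex.ofReal_prod, smul_eq_mul,
        Complex.re_ofReal_mul]
    rw [← e]
    simp only [hK2]
    rw [MultilinearMap.map_smul_univ, ← Complex.ofReal_prod, smul_eq_mul, Complex.re_ofReal_mul,
      hΦ, MultilinearMap.curryMid_apply_apply]
    congr 1
    have e1 : (p.insertNth (α := fun n => H n →L[ℂ] H n) 1 fun _ => 1) = fun _ => 1 :=
      funext ((Fin.forall_iff_succAbove p).2 ⟨by simp, by simp⟩)
    rw [e1, tensorExpectation_apply, tensorOp_one]
    exact inner_self_eq_norm_sq (𝕜 := ℂ) v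
  have hswap : ∑ s, ∑ l, ψ s l * (tensorExpectation H v fun n => (M n (s n)).effect (l n)).re
      = ∑ i : ∀ j, I j, (∏ j, c j (i j)) * ∑ s, ∑ l, ψ s l *
          (G i ((M p (s p)).effect (l p)) *
          ∏ j, if r j (i j) (s (p.succAbove j)) = l (p.succAbove j) then 1 else 0) := by
    simp_rw [hexp, Finset.mul_sum]
    rw [Finset.sum_congr rfl fun s _ => Finset.sum_comm, Finset.sum_comm]
    refine Finset.sum_congr rfl fun i _ => Finset.sum_congr rfl fun s _ =>
      Finset.sum_congr rfl fun l _ => ?_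
    ring
  rw [hswap, mul_right_comm, ← hone, Finset.sum_mul]
  refine (Finset.abs_sum_le_sum_abs _ _).trans (Finset.sum_le_sum fun i _ => ?_)
  rw [abs_mul, Finset.abs_prod, mul_assoc]
  refine mul_le_mul_of_nonneg_left ?_ (Finset.prod_nonneg fun j _ => abs_nonneg _)
  -- For fixed `i` the other sites are deterministic, and the weights at `p` sum to `G i 1` for
  -- every setting because the effects sum to the identity.
  have := abs_sum_mul_prod_succAbove_le p ψ (fun s l => G i ((M p s).effect l)) (G i 1)
    (fun s l => hG0 i _ ((M p s).isPositive l)) (hG0 i 1 ContinuousLinearMap.isPositive_one)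
    (fun s => by
      simp only [G]
      rw [← Complex.re_sum, ← sum_apply, ← map_sum, (M p s).sum_effect])
    (fun j s l => if r j (i j) s = l then 1 else 0) (fun _ => 1)
    (fun j s l => by split_ifs <;> norm_num) (fun _ => zero_le_one) (fun j s => by simp)
  simpa using this

/-- The value of the Bell functional on `⟪x₀ ⊗ x₁ ⊗ ⋯, (M₀ ⊗ M₁ ⊗ ⋯) (y₀ ⊗ y₁ ⊗ ⋯)⟫`. -/
theorem abs_sum_prod_inner_le (p : Fin (k + 1)) (M : ∀ n, Fin (S n) → POVM (H n) (Λ n))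
    (ψ : (∀ n, Fin (S n)) → (∀ n, Λ n) → ℝ) (x y : ∀ n, H n) :
    |∑ s, ∑ l, ψ s l * (∏ n, inner ℂ (x n) ((M n (s n)).effect (l n) (y n))).re|
      ≤ (‖x p‖ ^ 2 + ‖y p‖ ^ 2) / 2 *
        (∏ i, (‖x (p.succAbove i)‖ ^ 2 + ‖y (p.succAbove i)‖ ^ 2)) * lhvBound ψ := by
  choose ω z hω hz hB using fun i : Fin k =>
    exists_polarization (x (p.succAbove i)) (y (p.succAbove i))
  let q (i : Fin k) (m : Fin 4) (s : Fin (S (p.succAbove i))) (l : Λ (p.succAbove i)) : ℝ :=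
    (inner ℂ (z i m) ((M _ s).effect l (z i m))).re / 4
  let g (ε : ℂ) (s : Fin (S p)) (l : Λ p) : ℝ :=
    (inner ℂ (x p + ε • y p) ((M p s).effect l (x p + ε • y p))).re / 4
  -- At `p` only a real part is needed, so two positive weights suffice instead of four. The factor
  -- `ε` will be the product of the polarization phases of all other sites.
  have hg (ε : ℂ) (hε : ‖ε‖ = 1) (s : Fin (S p)) (l : Λ p) :
      (ε * inner ℂ (x p) ((M p s).effect l (y p))).re = g ε s l - g (-ε) s l := by
    have hsymm : inner ℂ (y p) ((M p s).effect l (x p))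
        = conj (inner ℂ (x p) ((M p s).effect l (y p))) := by
      rw [inner_conj_symm]
      exact (((M p s).isPositive l).isSymmetric _ _).symm
    simp only [g, map_add, map_smul, inner_add_left, inner_add_right, inner_smul_left,
      inner_smul_right, hsymm, Complex.add_re, Complex.add_im, Complex.mul_re, Complex.mul_im,
      Complex.conj_re,
      Complex.conj_im, Complex.neg_re, Complex.neg_im]
    ring
  have hexp (s : ∀ n, Fin (S n)) (l : ∀ n, Λ n) :
      (∏ n, inner ℂ (x n) ((M n (s n)).effect (l n) (y n))).re
        = ∑ m : Fin k → Fin 4, (g (∏ i, ω i (m i)) (s p) (l p) - g (-∏ i, ω i (m i)) (s p) (l p)) *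
          ∏ i, q i (m i) (s (p.succAbove i)) (l (p.succAbove i)) := by
    have hq (i m) (s : Fin (S (p.succAbove i))) (l : Λ (p.succAbove i)) :
        inner ℂ (z i m) ((M _ s).effect l (z i m)) / 4 = (q i m s l : ℂ) := by
      rw [POVM.inner_eq_re]
      simp [q]
    rw [Fin.prod_univ_succAbove _ p]
    simp_rw [hB, hq]
    rw [Finset.prod_univ_sum, Fintype.piFinset_univ, Finset.mul_sum, Complex.re_sum]
    refine Finset.sum_congr rfl fun m _ => ?_
    rw [← hg _ (by rw [norm_prod]; exact Finset.prod_eq_one fun i _ => hω i _),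
      Finset.prod_mul_distrib, ← Complex.ofReal_prod, ← mul_assoc, Complex.re_mul_ofReal,
      mul_comm (inner ℂ _ _)]
  have hswap : ∑ s, ∑ l, ψ s l * (∏ n, inner ℂ (x n) ((M n (s n)).effect (l n) (y n))).re
      = ∑ m : Fin k → Fin 4,
        (∑ s, ∑ l, ψ s l * (g (∏ i, ω i (m i)) (s p) (l p) *
            ∏ i, q i (m i) (s (p.succAbove i)) (l (p.succAbove i)))
          - ∑ s, ∑ l, ψ s l * (g (-∏ i, ω i (m i)) (s p) (l p) *
            ∏ i, q i (m i) (s (p.succAbove i)) (l (p.succAbove i)))) := by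
    simp_rw [hexp, Finset.mul_sum]
    rw [Finset.sum_congr rfl fun s _ => Finset.sum_comm, Finset.sum_comm]
    refine Finset.sum_congr rfl fun m _ => ?_
    simp_rw [← Finset.sum_sub_distrib]
    refine Finset.sum_congr rfl fun s _ => Finset.sum_congr rfl fun l _ => ?_
    ring
  have hbound (ε : ℂ) (m : Fin k → Fin 4) :
      |∑ s, ∑ l, ψ s l * (g ε (s p) (l p) *
          ∏ i, q i (m i) (s (p.succAbove i)) (l (p.succAbove i)))|
        ≤ ‖x p + ε • y p‖ ^ 2 / 4 * (∏ i, ‖z i (m i)‖ ^ 2 / 4) * lhvBound ψ := by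
    refine abs_sum_mul_prod_succAbove_le p ψ (g ε) _
      (fun s l => div_nonneg ((M p s).re_inner_nonneg l _) (by norm_num)) (by positivity)
      (fun s => ?_) (fun i => q i (m i)) _
      (fun i s l => div_nonneg ((M _ s).re_inner_nonneg l _) (by norm_num))
      (fun i => by positivity) fun i s => ?_
    · simp only [g, ← Finset.sum_div, POVM.sum_re_inner]
    · simp only [q, ← Finset.sum_div, POVM.sum_re_inner]
  have hprod : ∏ i, (‖x (p.succAbove i)‖ ^ 2 + ‖y (p.succAbove i)‖ ^ 2)
      = ∑ m : Fin k → Fin 4, ∏ i, ‖z i (m i)‖ ^ 2 / 4 := by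
    simp_rw [← hz]
    rw [Finset.prod_univ_sum, Fintype.piFinset_univ]
  rw [hswap, hprod, Finset.mul_sum, Finset.sum_mul]
  refine (Finset.abs_sum_le_sum_abs _ _).trans (Finset.sum_le_sum fun m _ => ?_)
  refine (abs_sub _ _).trans ((add_le_add (hbound _ m) (hbound _ m)).trans_eq ?_)
  have hn : ‖∏ i, ω i (m i)‖ = 1 := by
    rw [norm_prod]
    exact Finset.prod_eq_one fun i _ => hω i _
  -- The two weights at `p` have total mass `(‖x p‖ ^ 2 + ‖y p‖ ^ 2) / 2`, half of what full
  -- polarization costs at the other sites.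
  have h := parallelogram_law_with_norm ℂ (x p) ((∏ i, ω i (m i)) • y p)
  rw [norm_smul, hn, one_mul] at h
  rw [neg_smul, ← sub_eq_add_neg]
  linear_combination ((∏ i, ‖z i (m i)‖ ^ 2 / 4) * lhvBound ψ / 4) * h

theorem inner_sum_elemTensor {J : Type*} [Fintype J] (x : J → ∀ n, H n)
    (A : ∀ n, H n →L[ℂ] H n) :
    tensorExpectation H (∑ j, elemTensor (x j)) A
      = ∑ i, ∑ j, ∏ n, inner ℂ (x i n) (A n (x j n)) := by
  rw [tensorExpectation_apply, map_sum, sum_inner]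
  simp_rw [inner_sum, tensorOp_elemTensor, inner_elemTensor]

/-- Vectors of the algebraic tensor product in terms of orthonormal bases at all sites but one. -/
theorem exists_eq_sum_elemTensor [∀ n, FiniteDimensional ℂ (H n)] (p : Fin (k + 1))
    (t : AlgTensor H) :
    ∃ φ : (∀ i, Fin (Module.finrank ℂ (H (p.succAbove i)))) → H p,
      (t : HilbertTensor H) = ∑ j, elemTensor (p.insertNth (φ j) fun i =>
        stdOrthonormalBasis ℂ (H (p.succAbove i)) (j i)) := by
  set e := fun i => stdOrthonormalBasis ℂ (H (p.succAbove i))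
  set Ψ := (elemTensorMultilinear (H := H)).curryMid p
  have hΨ (a : H p) (b) : elemTensor (p.insertNth a b) = Ψ a b := rfl
  simp_rw [hΨ]
  have ht := tprod_mem_span t
  induction ht using Submodule.span_induction with
  | mem x hx =>
    obtain ⟨x, rfl⟩ := hx
    refine ⟨fun j => (∏ i, inner ℂ (e i (j i)) (x (p.succAbove i))) • x p, ?_⟩
    have h1 : elemTensor x = Ψ (x p) fun i => x (p.succAbove i) :=
      congrArg elemTensor (Fin.insertNth_self_removeNth p x).symm
    have h2 : (fun i => x (p.succAbove i))
        = fun i => ∑ a, inner ℂ (e i a) (x (p.succAbove i)) • e i a :=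
      funext fun i => ((e i).sum_repr' _).symm
    refine h1.trans ?_
    rw [h2, MultilinearMap.map_sum]
    refine Finset.sum_congr rfl fun j _ => ?_
    rw [MultilinearMap.map_smul_univ, map_smul, smul_apply]
  | zero => exact ⟨0, by simp [UniformSpace.Completion.coe_zero]⟩
  | add s t _ _ hs ht =>
    obtain ⟨φ, hφ⟩ := hs
    obtain ⟨χ, hχ⟩ := ht
    exact ⟨φ + χ, by
      simp [UniformSpace.Completion.coe_add, hφ, hχ, Finset.sum_add_distrib]⟩
  | smul c t _ ht =>
    obtain ⟨φ, hφ⟩ := ht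
    exact ⟨c • φ, by simp [UniformSpace.Completion.coe_smul, hφ, Finset.smul_sum]⟩

/-- Vector states: the bound by the dimensions. -/
theorem abs_sum_tensorExpectation_le_dimension [∀ n, FiniteDimensional ℂ (H n)]
    (p : Fin (k + 1)) (M : ∀ n, Fin (S n) → POVM (H n) (Λ n))
    (ψ : (∀ n, Fin (S n)) → (∀ n, Λ n) → ℝ) (v : HilbertTensor H) :
    |∑ s, ∑ l, ψ s l * (tensorExpectation H v fun n => (M n (s n)).effect (l n)).re|
      ≤ (1 + 2 ^ k * (∏ i, (Module.finrank ℂ (H (p.succAbove i)) : ℝ) - 1)) * lhvBound ψ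
        * ‖v‖ ^ 2 := by
  induction v using UniformSpace.Completion.induction_on with
  | hp =>
    simp_rw [tensorExpectation_apply]
    refine isClosed_le ?_ ?_
    · refine continuous_abs.comp (continuous_finsetSum _ fun s _ => continuous_finsetSum _
        fun l _ => continuous_const.mul (Complex.continuous_re.comp ?_))
      exact continuous_id.inner (tensorOp _).continuous
    · fun_prop
  | ih t =>
    obtain ⟨φ, hφ⟩ := exists_eq_sum_elemTensor p t
    let J := ∀ i, Fin (Module.finrank ℂ (H (p.succAbove i)))
    let x (j : J) : ∀ n, H n := p.insertNth (φ j) fun i =>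
      stdOrthonormalBasis ℂ (H (p.succAbove i)) (j i)
    have ht : (t : HilbertTensor H) = ∑ j, elemTensor (x j) := hφ
    have hxp (j) : x j p = φ j := by simp [x]
    have hxi (j i) : x j (p.succAbove i) = stdOrthonormalBasis ℂ (H (p.succAbove i)) (j i) := by
      simp [x]
    have hnorm (j i) : ‖x j (p.succAbove i)‖ = 1 := by
      rw [hxi, OrthonormalBasis.norm_eq_one]
    have hv : ‖∑ j, elemTensor (x j)‖ ^ 2 = ∑ j, ‖φ j‖ ^ 2 := by
      have h1 : ((‖∑ j, elemTensor (x j)‖ ^ 2 : ℝ) : ℂ) = ((∑ j, ‖φ j‖ ^ 2 : ℝ) : ℂ) := by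
        have h2 := inner_self_eq_norm_sq_to_K (𝕜 := ℂ) (∑ j, elemTensor (x j))
        push_cast
        refine h2.symm.trans ?_
        rw [sum_inner]
        refine Finset.sum_congr rfl fun j _ => ?_
        rw [inner_sum, Finset.sum_eq_single j]
        · rw [inner_elemTensor, Fin.prod_univ_succAbove _ p]
          simp [inner_self_eq_norm_sq_to_K, hnorm, hxp]
        · intro i _ hij
          obtain ⟨a, ha⟩ := Function.ne_iff.1 hij
          rw [inner_elemTensor]
          refine Finset.prod_eq_zero (Finset.mem_univ (p.succAbove a)) ?_
          rw [hxi, hxi, OrthonormalBasis.inner_eq_ite, if_neg ha.symm]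
        · simp
      exact_mod_cast h1
    -- The `if` term lowers the general cost `2 ^ k * ‖φ i‖ ^ 2` of a diagonal pair to `‖φ i‖ ^ 2`,
    -- since that pair needs no polarization.
    have hpair (i j : J) :
        |∑ s, ∑ l, ψ s l * (∏ n, inner ℂ (x i n) ((M n (s n)).effect (l n) (x j n))).re|
          ≤ ((‖φ i‖ ^ 2 + ‖φ j‖ ^ 2) / 2 * 2 ^ k + if i = j then (1 - 2 ^ k) * ‖φ i‖ ^ 2 else 0)
            * lhvBound ψ := by
      split_ifs with hij
      · subst hij
        have h := abs_sum_prod_le ψ (fun n s l => (inner ℂ (x i n) ((M n s).effect l (x i n))).re)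
          (fun n => ‖x i n‖ ^ 2) (fun n s l => (M n s).re_inner_nonneg l _)
          (fun n => sq_nonneg _) fun n s => (M n s).sum_re_inner _
        rw [Fin.prod_univ_succAbove _ p, hxp, Finset.prod_eq_one fun a _ => by
          rw [hnorm, one_pow]] at h
        have e (s : ∀ n, Fin (S n)) (l : ∀ n, Λ n) :
            (∏ n, inner ℂ (x i n) ((M n (s n)).effect (l n) (x i n))).re
              = ∏ n, (inner ℂ (x i n) ((M n (s n)).effect (l n) (x i n))).re := by
          rw [← Complex.ofReal_re (∏ n, _), Complex.ofReal_prod]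
          simp_rw [← POVM.inner_eq_re]
        simp_rw [e]
        refine h.trans_eq ?_
        ring
      · have h := abs_sum_prod_inner_le p M ψ (x i) (x j)
        simp only [hnorm, hxp] at h
        refine h.trans_eq ?_
        norm_num
    have hswap : ∑ s, ∑ l, ψ s l *
          (tensorExpectation H (∑ j, elemTensor (x j)) fun n => (M n (s n)).effect (l n)).re
        = ∑ i, ∑ j, ∑ s, ∑ l, ψ s l *
          (∏ n, inner ℂ (x i n) ((M n (s n)).effect (l n) (x j n))).re := by
      simp_rw [inner_sum_elemTensor, Complex.re_sum, Finset.mul_sum]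
      rw [Finset.sum_congr rfl fun s _ => Finset.sum_comm, Finset.sum_comm]
      refine Finset.sum_congr rfl fun i _ => ?_
      rw [Finset.sum_congr rfl fun s _ => Finset.sum_comm, Finset.sum_comm]
    rw [ht, hswap, hv]
    calc _ ≤ ∑ i, ∑ j, ((‖φ i‖ ^ 2 + ‖φ j‖ ^ 2) / 2 * 2 ^ k
              + if i = j then (1 - 2 ^ k) * ‖φ i‖ ^ 2 else 0) * lhvBound ψ :=
          (Finset.abs_sum_le_sum_abs _ _).trans (Finset.sum_le_sum fun i _ =>
            (Finset.abs_sum_le_sum_abs _ _).trans (Finset.sum_le_sum fun j _ => hpair i j))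
      _ = _ := by
          have hcard : (Fintype.card J : ℝ)
              = ∏ i, (Module.finrank ℂ (H (p.succAbove i)) : ℝ) := by
            simp [J, Fintype.card_pi]
          have hrow (i : J) : ∑ j, ((‖φ i‖ ^ 2 + ‖φ j‖ ^ 2) / 2 * 2 ^ k
                + if i = j then (1 - 2 ^ k) * ‖φ i‖ ^ 2 else 0) * lhvBound ψ
              = ((Fintype.card J * ‖φ i‖ ^ 2 + ∑ j, ‖φ j‖ ^ 2) / 2 * 2 ^ k
                + (1 - 2 ^ k) * ‖φ i‖ ^ 2) * lhvBound ψ := by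
            rw [← Finset.sum_mul, Finset.sum_add_distrib, ← Finset.sum_mul, ← Finset.sum_div,
              Finset.sum_add_distrib, Finset.sum_const, Finset.card_univ, nsmul_eq_mul,
              Finset.sum_ite_eq, if_pos (Finset.mem_univ i)]
          rw [Finset.sum_congr rfl fun i _ => hrow i, ← Finset.sum_mul, Finset.sum_add_distrib,
            ← Finset.sum_mul, ← Finset.sum_div, Finset.sum_add_distrib, ← Finset.mul_sum,
            ← Finset.mul_sum, Finset.sum_const, Finset.card_univ, nsmul_eq_mul, hcard]
          ring

end Vector

/-! ### Bounds for states -/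

section State

/-- Nonzero dimension: a Hilbert space tensor product carrying a state has no trivial factor. -/
theorem IsState.nontrivial {N : ℕ} {H : Fin N → Type u} [∀ n, NormedAddCommGroup (H n)]
    [∀ n, InnerProductSpace ℂ (H n)] {ρ : HilbertTensor H →L[ℂ] HilbertTensor H}
    (hρ : IsState ρ) (n : Fin N) : Nontrivial (H n) := by
  by_contra h
  rw [not_nontrivial_iff_subsingleton] at h
  have h0 : ρ = 0 := ext_elemTensor fun x => by
    have : elemTensor x = 0 := by
      rw [← elemTensorMultilinear_apply]
      exact elemTensorMultilinear.map_coord_zero n (Subsingleton.elim _ _)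
    rw [this, map_zero, map_zero]
  have := hρ.trace_eq_one
  simp [trace, h0] at this

variable {k : ℕ} {H : Fin (k + 1) → Type u} [∀ n, NormedAddCommGroup (H n)]
  [∀ n, InnerProductSpace ℂ (H n)] {Λ : Fin (k + 1) → Type v} [∀ n, Fintype (Λ n)]
  {S : Fin (k + 1) → ℕ}

/-- A bound for all vector states is a bound for the maximal violation by any state. -/
theorem maxViolation_le_of_forall_vector {ρ : HilbertTensor H →L[ℂ] HilbertTensor H}
    (hρ : IsState ρ) (C : ℝ)
    (h : ∀ (M : ∀ n, Fin (S n) → POVM (H n) (Λ n)) (ψ : (∀ n, Fin (S n)) → (∀ n, Λ n) → ℝ)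
      (v : HilbertTensor H),
      |∑ s, ∑ l, ψ s l * (tensorExpectation H v fun n => (M n (s n)).effect (l n)).re|
        ≤ C * lhvBound ψ * ‖v‖ ^ 2) :
    maxViolation Λ S ρ ≤ ENNReal.ofReal C := by
  -- The multiplicative form also covers `lhvBound ψ = 0`: the quantum value then vanishes and the
  -- quotient is `0 / 0 = 0`.
  refine iSup₂_le fun M ψ => ENNReal.div_le_of_le_mul ?_
  rw [← ENNReal.ofReal_mul' (lhvBound_nonneg ψ)]
  refine ENNReal.ofReal_le_ofReal ?_
  obtain ⟨w, hw, hA⟩ := hρ.exists_hasSum_inner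
  have h1 : HasSum (fun i => ∑ s, ∑ l, ψ s l *
      (tensorExpectation H (w i) fun n => (M n (s n)).effect (l n)).re) (quantumValue ρ M ψ) :=
    hasSum_sum fun s _ => hasSum_sum fun l _ =>
      (hA (tensorOp fun n => (M n (s n)).effect (l n))).mul_left (ψ s l)
  have h2 := hw.mul_left (C * lhvBound ψ)
  rw [mul_one] at h2
  refine abs_le.2 ⟨?_, hasSum_le (fun i => (abs_le.1 (h M ψ (w i))).2) h1 h2⟩
  exact hasSum_le (fun i => (abs_le.1 (h M ψ (w i))).1) h2.neg h1

theorem maxViolation_le_settings [∀ n, CompleteSpace (H n)]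
    {ρ : HilbertTensor H →L[ℂ] HilbertTensor H} (hρ : IsState ρ) (hS : ∀ n, 1 ≤ S n)
    (p : Fin (k + 1)) :
    maxViolation Λ S ρ ≤ ENNReal.ofReal (∏ i, (2 * (S (p.succAbove i) : ℝ) - 1)) :=
  maxViolation_le_of_forall_vector hρ _ (abs_sum_tensorExpectation_le_settings p hS)

theorem maxViolation_le_prodDivMax_settings [∀ n, CompleteSpace (H n)]
    {ρ : HilbertTensor H →L[ℂ] HilbertTensor H} (hρ : IsState ρ) (hS : ∀ n, 1 ≤ S n) :
    maxViolation Λ S ρ ≤ ENNReal.ofReal (1 + 2 ^ k * (prodDivMax S - 1)) := by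
  obtain ⟨p, hp⟩ := Finite.exists_max S
  refine (maxViolation_le_settings hρ hS p).trans (ENNReal.ofReal_le_ofReal ?_)
  rw [prodDivMax_eq_prod_succAbove S p hp (Nat.one_le_iff_ne_zero.1 (hS p))]
  exact (one_le_prod_and_prod_two_mul_sub_one_le _ fun i => hS _).2

theorem maxViolation_le_prodDivMax_finrank [∀ n, FiniteDimensional ℂ (H n)]
    {ρ : HilbertTensor H →L[ℂ] HilbertTensor H} (hρ : IsState ρ) :
    maxViolation Λ S ρ ≤ ENNReal.ofReal
      (1 + 2 ^ k * ((prodDivMax fun n => Module.finrank ℂ (H n)) - 1)) := by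
  obtain ⟨p, hp⟩ := Finite.exists_max fun n => Module.finrank ℂ (H n)
  -- The largest dimension is nonzero, so the division in `prodDivMax` is genuine.
  have := hρ.nontrivial p
  rw [prodDivMax_eq_prod_succAbove _ p hp Module.finrank_pos.ne']
  exact maxViolation_le_of_forall_vector hρ _ (abs_sum_tensorExpectation_le_dimension p)

theorem maxViolation_const_le [∀ n, CompleteSpace (H n)]
    {ρ : HilbertTensor H →L[ℂ] HilbertTensor H} (hρ : IsState ρ) {T : ℕ} (hT : 1 ≤ T) :
    maxViolation Λ (fun _ => T) ρ ≤ ENNReal.ofReal ((2 * (T : ℝ) - 1) ^ k) := by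
  simpa using maxViolation_le_settings (Λ := Λ) (S := fun _ => T) hρ (fun _ => hT) 0

end State

end BellViolation

end

theorem mainTheorem1 {N : ℕ} (hN : 1 ≤ N) (H : Fin N → Type*)
    [∀ n, NormedAddCommGroup (H n)] [∀ n, InnerProductSpace ℂ (H n)] [∀ n, CompleteSpace (H n)]
    (ρ : BellViolation.HilbertTensor H →L[ℂ] BellViolation.HilbertTensor H)
    (hρ : BellViolation.IsState ρ)
    (Λ : Fin N → Type*) [∀ n, Fintype (Λ n)] :
    -- arbitrary numbers of settings, finite-dimensional site spaces
    (∀ S : Fin N → ℕ, (∀ n, 1 ≤ S n) → (∀ n, FiniteDimensional ℂ (H n)) →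
      BellViolation.maxViolation Λ S ρ ≤
        ENNReal.ofReal (1 + 2 ^ (N - 1) *
          (min (BellViolation.prodDivMax S)
            (BellViolation.prodDivMax fun n => Module.finrank ℂ (H n)) - 1))) ∧
    -- the same number of settings at every site, finite-dimensional site spaces
    (∀ S : ℕ, 1 ≤ S → (∀ n, FiniteDimensional ℂ (H n)) →
      BellViolation.maxViolation Λ (fun _ => S) ρ ≤
          ENNReal.ofReal (min ((2 * (S : ℝ) - 1) ^ (N - 1))
            (1 + 2 ^ (N - 1) *
              ((BellViolation.prodDivMax fun n => Module.finrank ℂ (H n)) - 1))) ∧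
        min ((2 * (S : ℝ) - 1) ^ (N - 1))
            (1 + 2 ^ (N - 1) *
              ((BellViolation.prodDivMax fun n => Module.finrank ℂ (H n)) - 1)) ≤
          1 + 2 ^ (N - 1) *
            (min ((S : ℝ) ^ (N - 1))
              (BellViolation.prodDivMax fun n => Module.finrank ℂ (H n)) - 1)) ∧
    -- the same number of settings at every site, Hilbert spaces of arbitrary dimension
    (∀ S : ℕ, 1 ≤ S →
      BellViolation.maxViolation Λ (fun _ => S) ρ ≤
        ENNReal.ofReal ((2 * (S : ℝ) - 1) ^ (N - 1))) := by
  obtain ⟨k, rfl⟩ : ∃ k, N = k + 1 := ⟨N - 1, by omega⟩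
  simp only [Nat.add_sub_cancel]
  refine ⟨fun S hS hd => ?_, fun S hS hd => ⟨?_, ?_⟩, fun S hS =>
    BellViolation.maxViolation_const_le hρ hS⟩
  -- The two bounds are independent and may exempt different sites.
  · rcases min_choice (BellViolation.prodDivMax S)
      (BellViolation.prodDivMax fun n => Module.finrank ℂ (H n)) with h | h <;> rw [h]
    · exact BellViolation.maxViolation_le_prodDivMax_settings hρ hS
    · exact BellViolation.maxViolation_le_prodDivMax_finrank hρ
  · rw [ENNReal.ofReal_min]
    exact le_min (BellViolation.maxViolation_const_le hρ hS)
      (BellViolation.maxViolation_le_prodDivMax_finrank hρ)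
  · have h := (BellViolation.one_le_prod_and_prod_two_mul_sub_one_le (k := k) (fun _ => S)
      fun _ => hS).2
    simp only [Finset.prod_const, Finset.card_univ, Fintype.card_fin] at h
    rcases min_choice ((S : ℝ) ^ k)
      (BellViolation.prodDivMax fun n => Module.finrank ℂ (H n)) with h' | h' <;> rw [h']
    · exact (min_le_left _ _).trans h
    · exact min_le_right _ _
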